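/- Let $d\in\mathbb N$ and let $G(\mathbb R^d)=\exp(\mathbb R^d\oplus so(d))$ be the free nilpotent group of step $2$ over $\mathbb R^d$, where $so(d)$ is the space of antisymmetric real $d\times d$ matrices, with product $$\exp(a^1,a^2)\otimes\exp(b^1,b^2)=\exp\left(a^1+b^1,\ a^2+b^2+\tfrac12(a^1\otimes b^1-b^1\otimes a^1)\right)$$ and projections $\pi_1(\exp(a^1,a^2))=a^1\in\mathbb R^d$, $\pi_2(\exp(a^1,a^2))=a^2\in so(d)$. Put $$\|g\|=\inf\Big\{\sum_{i=1}^n|x^i| : x^1,\dots,x^n\in\mathbb R^d,\ \exp(x^1,0)\otimes\cdots\otimes\exp(x^n,0)=g\Big\},\qquad d(g,h)=\|h^{-1}\otimes g\|,$$ with $|\cdot|$ the Euclidean norm. A $G(\mathbb R^d)$-valued path is a continuous map $\mathbf x:[0,1]\to G(\mathbb R^d)$ with $\mathbf x_0=\exp(0)$; its increments are $\mathbf x_{s,t}=\mathbf x_s^{-1}\otimes\mathbf x_t$. A control is a function $\omega:\{0\le s\le t\le1\}\to[0,\infty)$ that is continuous in a neighbourhood of the diagonal, vanishes on the diagonal and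 is super-additive, i.e. $\omega(s,t)+\omega(t,u)\le\omega(s,u)$ for $s\le t\le u$. The $p$-variation of $\mathbf x$ is controlled by $\omega$ if $\|\mathbf x_{s,t}\|^p\le\omega(s,t)$ for all $0\le s\le t\le1$. For $G(\mathbb R^d)$-valued paths $\mathbf x,\mathbf f$ with first levels $x_t=\pi_1(\mathbf x_t)$, $f_t=\pi_1(\mathbf f_t)$ and $x_{s,t}=x_t-x_s$, $f_{s,t}=f_t-f_s$, the translation $T_{\mathbf f}(\mathbf x)$ is defined by $$\pi_1(T_{\mathbf f}(\mathbf x)_{s,t})=f_{s,t}+x_{s,t},$$ $$\pi_2(T_{\mathbf f}(\mathbf x)_{s,t})=\pi_2(\mathbf f_{s,t})+\pi_2(\mathbf x_{s,t})+\tfrac12\int_s^t f_{s,u}\otimes dx_u+\tfrac12\int_s^t x_{s,u}\otimes df_u-\tfrac12\int_s^t df_u\otimes x_{s,u}-\tfrac12\int_s^t dx_u\otimes f_{s,u},$$ the integrals being Young integrals, i.e. entrywise limits of Riemann–Stieltjes sums as the mesh of the partition tends to $0$. **Theorem.** Let $2\le p<3$ and let $q$ be a real number with $\frac1p+\frac1q>1$,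 and let $C_0\in\mathbb R$. There is a constant $C>0$, depending only on $d,p,q,C_0$, such that the following holds. Let $\omega,\varkappa$ be controls and $0\le\varepsilon<1$; let $\mathbf x$ be a $G(\mathbb R^d)$-valued path whose $p$-variation is controlled by $\varepsilon^p\omega$, and $\mathbf f$ a $G(\mathbb R^d)$-valued path whose $q$-variation is controlled by $\varkappa$; and assume that $\varkappa(s,t)^{1/q}\le C_0\,\omega(s,t)^{1/p}$ for all $0\le s\le t\le1$. Then for all $0\le s<t\le1$ the Young integrals in the definition of $T_{\mathbf f}(\mathbf x)_{s,t}$ exist, and $$d\left(T_{\mathbf f}(\mathbf x)_{s,t},\mathbf f_{s,t}\right)\le C\sqrt{\varepsilon}\,\omega(s,t)^{1/p}.$$ -/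

import Mathlib

open Set

noncomputable section

/-- The step-two free nilpotent group `G(ℝ^d) = exp (ℝ^d ⊕ so(d))`, in exponential coordinates:
`StepTwoGroup.exp a A` is the group element `exp (a, A)`. The two fields are the projections
`π₁` onto `ℝ^d` and `π₂` onto `so(d)`. -/
@[ext]
structure StepTwoGroup (d : ℕ) where
  exp ::
  /-- the `ℝ^d` component -/
  π₁ : EuclideanSpace ℝ (Fin d)
  /-- the `so(d)` component (antisymmetric real matrices) -/
  π₂ : LieAlgebra.Orthogonal.so (Fin d) ℝ

namespace StepTwoGroup

variable {d : ℕ}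

/-- The antisymmetric matrix `a ⊗ b - b ⊗ a`, that is, the bracket of `(a, A)` and `(b, B)` in
`ℝ^d ⊕ so(d)` is `(0, bracket a b)`. -/
def bracket (a b : EuclideanSpace ℝ (Fin d)) : LieAlgebra.Orthogonal.so (Fin d) ℝ :=
  ⟨Matrix.of fun i j => a i * b j - b i * a j, by
    rw [LieAlgebra.Orthogonal.mem_so]
    ext i j
    simp [Matrix.transpose_apply]
    ring⟩

theorem bracket_apply (a b : EuclideanSpace ℝ (Fin d)) (i j : Fin d) :
    (bracket a b : Matrix (Fin d) (Fin d) ℝ) i j = a i * b j - b i * a j := rfl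

theorem ext_apply {g h : StepTwoGroup d} (h₁ : ∀ i, g.π₁ i = h.π₁ i)
    (h₂ : ∀ i j, (g.π₂ : Matrix (Fin d) (Fin d) ℝ) i j = (h.π₂ : Matrix (Fin d) (Fin d) ℝ) i j) :
    g = h := by
  apply StepTwoGroup.ext
  · ext i
    exact h₁ i
  · apply Subtype.ext
    ext i j
    exact h₂ i j

/-- `exp a ⊗ exp b = exp (a + b + [a, b] / 2)`. -/
instance : Mul (StepTwoGroup d) :=
  ⟨fun g h => exp (g.π₁ + h.π₁) (g.π₂ + h.π₂ + (1 / 2 : ℝ) • bracket g.π₁ h.π₁)⟩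

/-- The neutral element is `exp 0`. -/
instance : One (StepTwoGroup d) := ⟨exp 0 0⟩

/-- The inverse of `exp a` is `exp (-a)`. -/
instance : Inv (StepTwoGroup d) := ⟨fun g => exp (-g.π₁) (-g.π₂)⟩

theorem mul_π₁ (g h : StepTwoGroup d) (i : Fin d) : (g * h).π₁ i = g.π₁ i + h.π₁ i := rfl

theorem mul_π₂ (g h : StepTwoGroup d) (i j : Fin d) :
    ((g * h).π₂ : Matrix (Fin d) (Fin d) ℝ) i j =
      (g.π₂ : Matrix (Fin d) (Fin d) ℝ) i j + (h.π₂ : Matrix (Fin d) (Fin d) ℝ) i j +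
        (1 / 2 : ℝ) * (g.π₁ i * h.π₁ j - h.π₁ i * g.π₁ j) := rfl

theorem one_π₁ (i : Fin d) : (1 : StepTwoGroup d).π₁ i = 0 := rfl

theorem one_π₂ (i j : Fin d) :
    ((1 : StepTwoGroup d).π₂ : Matrix (Fin d) (Fin d) ℝ) i j = 0 := rfl

theorem inv_π₁ (g : StepTwoGroup d) (i : Fin d) : (g⁻¹).π₁ i = -g.π₁ i := rfl

theorem inv_π₂ (g : StepTwoGroup d) (i j : Fin d) :
    ((g⁻¹).π₂ : Matrix (Fin d) (Fin d) ℝ) i j = -(g.π₂ : Matrix (Fin d) (Fin d) ℝ) i j := rfl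

instance : Group (StepTwoGroup d) where
  mul_assoc a b c := by
    apply ext_apply
    · intro i
      simp only [mul_π₁]
      ring
    · intro i j
      simp only [mul_π₁, mul_π₂]
      ring
  one_mul a := by
    apply ext_apply
    · intro i
      simp only [mul_π₁, one_π₁]
      ring
    · intro i j
      simp only [mul_π₂, one_π₁, one_π₂]
      ring
  mul_one a := by
    apply ext_apply
    · intro i
      simp only [mul_π₁, one_π₁]
      ring
    · intro i j
      simp only [mul_π₂, one_π₁, one_π₂]
      ring
  inv_mul_cancel a := by
    apply ext_apply
    · intro i
      simp only [mul_π₁, inv_π₁, one_π₁]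
      ring
    · intro i j
      simp only [mul_π₂, inv_π₁, inv_π₂, one_π₂]
      ring

/-- The topology of `ℝ^d ⊕ so(d)`, through the global chart `exp`. -/
instance : TopologicalSpace (StepTwoGroup d) :=
  TopologicalSpace.induced (fun g => (g.π₁, g.π₂)) inferInstance

/-- The homogeneous norm: the infimum of `∑ |xᵢ|` (Euclidean norms) over all finite sequences
`x₁, …, xₙ` in `ℝ^d` with `exp x₁ ⊗ ⋯ ⊗ exp xₙ = g`. -/
def homNorm (g : StepTwoGroup d) : ℝ :=
  sInf {r : ℝ | ∃ l : List (EuclideanSpace ℝ (Fin d)),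
    (l.map fun v => exp v 0).prod = g ∧ (l.map fun v => ‖v‖).sum = r}

/-- The left-invariant distance `d(g, h) = ‖h⁻¹ ⊗ g‖`. -/
def homDist (g h : StepTwoGroup d) : ℝ := homNorm (h⁻¹ * g)

/-- The set of products `exp x₁ ⊗ ⋯ ⊗ exp xₙ` is the whole group, so that the infimum in `homNorm`
is never over the empty set. -/
theorem exists_list_prod_eq (g : StepTwoGroup d) :
    ∃ l : List (EuclideanSpace ℝ (Fin d)), (l.map fun v => exp v 0).prod = g := by
  suffices H : g ∈ Submonoid.closure (range fun v : EuclideanSpace ℝ (Fin d) => exp v 0) by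
    induction H using Submonoid.closure_induction with
    | mem x hx =>
      obtain ⟨v, rfl⟩ := hx
      exact ⟨[v], by simp⟩
    | one => exact ⟨[], rfl⟩
    | mul x y _ _ hx hy =>
      obtain ⟨l, rfl⟩ := hx
      obtain ⟨m, rfl⟩ := hy
      exact ⟨l ++ m, by simp⟩
  have hbase : ∀ v : EuclideanSpace ℝ (Fin d),
      exp v 0 ∈ Submonoid.closure (range fun v : EuclideanSpace ℝ (Fin d) => exp v 0) :=
    fun v => Submonoid.subset_closure ⟨v, rfl⟩
  have hbr : ∀ a b : EuclideanSpace ℝ (Fin d), exp 0 (bracket a b) ∈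
      Submonoid.closure (range fun v : EuclideanSpace ℝ (Fin d) => exp v 0) := by
    intro a b
    have h : exp 0 (bracket a b) = exp a 0 * exp b 0 * exp (-a) 0 * exp (-b) 0 := by
      apply ext_apply
      · intro i
        simp [mul_π₁]
      · intro i j
        simp [mul_π₁, mul_π₂, bracket_apply]
        ring
    rw [h]
    exact mul_mem (mul_mem (mul_mem (hbase _) (hbase _)) (hbase _)) (hbase _)
  have hsum : ∀ (s : Finset (Fin d × Fin d)) (F : Fin d × Fin d → LieAlgebra.Orthogonal.so (Fin d) ℝ),
      (∀ k, exp 0 (F k) ∈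
        Submonoid.closure (range fun v : EuclideanSpace ℝ (Fin d) => exp v 0)) →
      exp 0 (∑ k ∈ s, F k) ∈
        Submonoid.closure (range fun v : EuclideanSpace ℝ (Fin d) => exp v 0) := by
    intro s F hF
    induction s using Finset.induction_on with
    | empty => exact one_mem _
    | insert k s hk ih =>
      rw [Finset.sum_insert hk]
      have h : exp 0 (F k + ∑ k ∈ s, F k) = exp 0 (F k) * exp 0 (∑ k ∈ s, F k) := by
        apply ext_apply
        · intro i
          simp [mul_π₁]
        · intro i j
          rw [mul_π₂]
          simp
      rw [h]
      exact mul_mem (hF k) ih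
  have hA : g.π₂ = ∑ k : Fin d × Fin d,
      bracket (((1 / 2 : ℝ) * (g.π₂ : Matrix (Fin d) (Fin d) ℝ) k.1 k.2) •
        EuclideanSpace.single k.1 (1 : ℝ)) (EuclideanSpace.single k.2 (1 : ℝ)) := by
    apply Subtype.ext
    ext i j
    have hanti : (g.π₂ : Matrix (Fin d) (Fin d) ℝ) j i = -(g.π₂ : Matrix (Fin d) (Fin d) ℝ) i j := by
      have h := (LieAlgebra.Orthogonal.mem_so (Fin d) ℝ _).1 g.π₂.2
      exact congrFun (congrFun h i) j
    rw [AddSubmonoidClass.coe_finsetSum, Matrix.sum_apply, Fintype.sum_prod_type]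
    simp only [bracket_apply, PiLp.smul_apply, PiLp.single_apply, smul_eq_mul,
      Finset.sum_sub_distrib]
    simp [mul_ite, ite_mul, Finset.sum_ite_eq, hanti]
    ring
  have hg : g = exp g.π₁ 0 * exp 0 g.π₂ := by
    apply ext_apply
    · intro i
      simp [mul_π₁]
    · intro i j
      rw [mul_π₂]
      simp
  rw [hg, hA]
  exact mul_mem (hbase _) (hsum _ _ fun k => hbr _ _)

/-- The increment `x_{s,t} = x_s⁻¹ ⊗ x_t`. -/
def incr (x : ℝ → StepTwoGroup d) (s t : ℝ) : StepTwoGroup d := (x s)⁻¹ * x t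

/-- A `G(ℝ^d)`-valued path: continuous on `[0, 1]` and started at `exp 0`. (Values outside `[0, 1]`
play no role anywhere.) -/
def IsPath (x : ℝ → StepTwoGroup d) : Prop := ContinuousOn x (Icc 0 1) ∧ x 0 = 1

end StepTwoGroup

/-- A control function on `{0 ≤ s ≤ t ≤ 1}`: nonnegative, continuous near the diagonal,
super-additive, and zero on the diagonal. -/
structure IsControl (ω : ℝ → ℝ → ℝ) : Prop where
  nonneg : ∀ s t, 0 ≤ s → s ≤ t → t ≤ 1 → 0 ≤ ω s t
  continuous_near_diagonal : ∃ δ > 0, ContinuousOn (fun z : ℝ × ℝ => ω z.1 z.2)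
    {z | 0 ≤ z.1 ∧ z.1 ≤ z.2 ∧ z.2 ≤ 1 ∧ z.2 - z.1 < δ}
  superadditive : ∀ s t u, 0 ≤ s → s ≤ t → t ≤ u → u ≤ 1 → ω s t + ω t u ≤ ω s u
  diagonal : ∀ t, 0 ≤ t → t ≤ 1 → ω t t = 0

/-- The `p`-variation of the group-valued path `x` is controlled by `ω`. -/
def StepTwoGroup.VariationControlledBy {d : ℕ} (p : ℝ) (ω : ℝ → ℝ → ℝ)
    (x : ℝ → StepTwoGroup d) : Prop :=
  ∀ s t, 0 ≤ s → s ≤ t → t ≤ 1 → (StepTwoGroup.incr x s t).homNorm ^ p ≤ ω s t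

/-- `I` is the integral `∫_s^t a_u db_u` in the sense of Young: the limit of the Riemann–Stieltjes
sums `∑ᵢ a(ξᵢ) (b(τᵢ₊₁) - b(τᵢ))`, `τᵢ ≤ ξᵢ ≤ τᵢ₊₁`, as the mesh of the partition
`s = τ₀ ≤ ⋯ ≤ τₙ = t` tends to zero. -/
def HasYoungIntegral (a b : ℝ → ℝ) (s t I : ℝ) : Prop :=
  ∀ η > 0, ∃ δ > 0, ∀ (n : ℕ) (τ ξ : ℕ → ℝ), τ 0 = s → τ n = t →
    (∀ i < n, τ i ≤ ξ i ∧ ξ i ≤ τ (i + 1) ∧ τ (i + 1) - τ i < δ) →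
    |∑ i ∈ Finset.range n, a (ξ i) * (b (τ (i + 1)) - b (τ i)) - I| < η

theorem HasYoungIntegral.unique {a b : ℝ → ℝ} {s t I J : ℝ} (hst : s ≤ t)
    (hI : HasYoungIntegral a b s t I) (hJ : HasYoungIntegral a b s t J) : I = J := by
  by_contra hne
  have hpos : 0 < |I - J| / 2 := half_pos (abs_pos.2 (sub_ne_zero.2 hne))
  obtain ⟨δ₁, h₁, H₁⟩ := hI _ hpos
  obtain ⟨δ₂, h₂, H₂⟩ := hJ _ hpos
  obtain ⟨n, hn⟩ := exists_nat_gt ((t - s) / min δ₁ δ₂)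
  have hδ : 0 < min δ₁ δ₂ := lt_min h₁ h₂
  have hn0 : (0 : ℝ) < n := lt_of_le_of_lt (div_nonneg (sub_nonneg.2 hst) hδ.le) hn
  have hmesh : (t - s) / n < min δ₁ δ₂ := by
    rw [div_lt_iff₀ hδ] at hn
    rw [div_lt_iff₀ hn0]
    linarith
  have hstep : ∀ i : ℕ, (s + ((i + 1 : ℕ) : ℝ) * ((t - s) / n)) - (s + (i : ℝ) * ((t - s) / n)) =
      (t - s) / n := by
    intro i
    push_cast
    ring
  have hnn : 0 ≤ (t - s) / n := div_nonneg (sub_nonneg.2 hst) hn0.le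
  have e₁ := H₁ n (fun i => s + (i : ℝ) * ((t - s) / n)) (fun i => s + (i : ℝ) * ((t - s) / n))
    (by simp) (by field_simp; ring) (fun i _ => ⟨le_rfl, by linarith [hstep i], by
      rw [hstep i]; exact hmesh.trans_le (min_le_left _ _)⟩)
  have e₂ := H₂ n (fun i => s + (i : ℝ) * ((t - s) / n)) (fun i => s + (i : ℝ) * ((t - s) / n))
    (by simp) (by field_simp; ring) (fun i _ => ⟨le_rfl, by linarith [hstep i], by
      rw [hstep i]; exact hmesh.trans_le (min_le_right _ _)⟩)
  rw [abs_lt] at e₁ e₂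
  rcases abs_cases (I - J) with ⟨h, _⟩ | ⟨h, _⟩ <;> rw [h] at e₁ e₂ <;> linarith [e₁.1, e₁.2, e₂.1, e₂.2]

/-- `a` is Young integrable against `b` on `[s, t]`. -/
def YoungIntegrable (a b : ℝ → ℝ) (s t : ℝ) : Prop := ∃ I, HasYoungIntegral a b s t I

open Classical in
/-- The Young integral `∫_s^t a_u db_u` (zero if it does not exist). -/
def youngIntegral (a b : ℝ → ℝ) (s t : ℝ) : ℝ :=
  if h : YoungIntegrable a b s t then h.choose else 0

namespace StepTwoGroup

variable {d : ℕ}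

/-- The matrix `∫_s^t y_{s,u} ⊗ dz_u`, where `y` and `z` are the first levels of `Y` and `Z`. -/
def integralTensorD (Y Z : ℝ → StepTwoGroup d) (s t : ℝ) : Matrix (Fin d) (Fin d) ℝ :=
  Matrix.of fun i j => youngIntegral (fun u => (incr Y s u).π₁ i) (fun u => (Z u).π₁ j) s t

/-- The matrix `∫_s^t dz_u ⊗ y_{s,u}`, where `y` and `z` are the first levels of `Y` and `Z`. -/
def integralDTensor (Z Y : ℝ → StepTwoGroup d) (s t : ℝ) : Matrix (Fin d) (Fin d) ℝ :=
  Matrix.of fun i j => youngIntegral (fun u => (incr Y s u).π₁ j) (fun u => (Z u).π₁ i) s t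

/-- The cross term `½ ∫ f_{s,u} ⊗ dx_u + ½ ∫ x_{s,u} ⊗ df_u - ½ ∫ df_u ⊗ x_{s,u} -
½ ∫ dx_u ⊗ f_{s,u}` (integrals over `[s, t]`), an antisymmetric matrix. -/
def crossArea (f x : ℝ → StepTwoGroup d) (s t : ℝ) : LieAlgebra.Orthogonal.so (Fin d) ℝ :=
  ⟨(1 / 2 : ℝ) • integralTensorD f x s t + (1 / 2 : ℝ) • integralTensorD x f s t
      - (1 / 2 : ℝ) • integralDTensor f x s t - (1 / 2 : ℝ) • integralDTensor x f s t, by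
    rw [LieAlgebra.Orthogonal.mem_so]
    ext i j
    simp [integralTensorD, integralDTensor, Matrix.transpose_apply]
    ring⟩

/-- The increment `T_f(x)_{s,t}` of the translation of `x` by `f`: the second level is the one
obtained by replacing the first level `x` by `x + f` in `½ ∫ (x_{s,u} ⊗ dx_u - dx_u ⊗ x_{s,u})`,
the mixed integrals being Young integrals. -/
def translate (f x : ℝ → StepTwoGroup d) (s t : ℝ) : StepTwoGroup d :=
  exp ((incr f s t).π₁ + (incr x s t).π₁)
    ((incr f s t).π₂ + (incr x s t).π₂ + crossArea f x s t)

/-- All Young integrals that enter `T_f(x)_{s,t}` exist. -/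
def TranslateDefined (f x : ℝ → StepTwoGroup d) (s t : ℝ) : Prop :=
  ∀ i j : Fin d,
    YoungIntegrable (fun u => (incr f s u).π₁ i) (fun u => (x u).π₁ j) s t ∧
      YoungIntegrable (fun u => (incr x s u).π₁ i) (fun u => (f u).π₁ j) s t

end StepTwoGroup

end

/-! Write `W = ω s t ^ (1 / p)`. In `(incr f s t)⁻¹ * translate f x s t` the pure `f` terms cancel
(`homDist_translate`): the first level is that of `x`, and the second is the area of `x`, plus the
mixed integrals, minus half the bracket of the increments of `f` and `x`. Every surviving term
contains `x`, hence a factor `ε`: the first level is at most `ε W`, and the second is entrywise of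
order `ε W²`.

The homogeneous norm is at most the Euclidean norm of the first level plus a multiple of the square
root of the largest second-level entry (`homNorm_le`). That root turns `ε W²` into `√ε W`.
Conversely, `norm_π₁_le` and `abs_π₂_le` extract coordinate bounds from the variation hypotheses.

The mixed integrals are handled by Young's theorem, through a sewing lemma. Controls are continuous
only near the diagonal, so sewing uses super-additivity alone: Young's maximal inequality on finite
sets (`abs_sum_sub_le`), then a compactness limit (`exists_sewing`). Smallness near the diagonal
enters only for convergence of Riemann–Stieltjes sums. -/

namespace StepTwoGroup

variable {d : ℕ}

/-! ### Homogeneous norm versus coordinates -/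

theorem homNorm_bddBelow (g : StepTwoGroup d) :
    BddBelow {r : ℝ | ∃ l : List (EuclideanSpace ℝ (Fin d)),
      (l.map fun v => exp v 0).prod = g ∧ (l.map fun v => ‖v‖).sum = r} := by
  refine ⟨0, ?_⟩
  rintro r ⟨l, -, rfl⟩
  apply List.sum_nonneg
  simp

theorem homNorm_le_sum (l : List (EuclideanSpace ℝ (Fin d))) :
    homNorm (l.map fun v => exp v 0).prod ≤ (l.map fun v => ‖v‖).sum :=
  csInf_le (homNorm_bddBelow _) ⟨l, rfl, rfl⟩

theorem le_homNorm {g : StepTwoGroup d} {c : ℝ}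
    (h : ∀ l : List (EuclideanSpace ℝ (Fin d)), (l.map fun v => exp v 0).prod = g →
      c ≤ (l.map fun v => ‖v‖).sum) : c ≤ homNorm g := by
  obtain ⟨l, hl⟩ := exists_list_prod_eq g
  refine le_csInf ⟨_, l, hl, rfl⟩ ?_
  rintro r ⟨m, hm, rfl⟩
  exact h m hm

theorem homNorm_nonneg (g : StepTwoGroup d) : 0 ≤ homNorm g :=
  le_homNorm fun l _ => List.sum_nonneg (by simp)

theorem homNorm_mul_le (g h : StepTwoGroup d) : homNorm (g * h) ≤ homNorm g + homNorm h := by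
  rw [← sub_le_iff_le_add]
  refine le_homNorm fun l hl => ?_
  rw [sub_le_comm]
  refine le_homNorm fun m hm => ?_
  rw [sub_le_iff_le_add, add_comm]
  have := homNorm_le_sum (l ++ m)
  simpa [hl, hm] using this

theorem homNorm_exp_zero_le (v : EuclideanSpace ℝ (Fin d)) : homNorm (exp v 0) ≤ ‖v‖ := by
  simpa using homNorm_le_sum [v]

theorem homNorm_one_le : homNorm (1 : StepTwoGroup d) ≤ 0 := by
  simpa using homNorm_le_sum (d := d) []

/-- In step two the group commutator is exactly the Lie bracket, so a bracket is reached by a word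
of four letters. -/
theorem exp_zero_bracket (a b : EuclideanSpace ℝ (Fin d)) :
    exp 0 (bracket a b) = exp a 0 * exp b 0 * exp (-a) 0 * exp (-b) 0 := by
  apply ext_apply
  · intro i
    simp [mul_π₁]
  · intro i j
    simp [mul_π₁, mul_π₂, bracket_apply]
    ring

theorem homNorm_bracket_le (a b : EuclideanSpace ℝ (Fin d)) :
    homNorm (exp 0 (bracket a b)) ≤ 2 * ‖a‖ + 2 * ‖b‖ := by
  have h := homNorm_le_sum [a, b, -a, -b]
  simp only [List.map_cons, List.map_nil, List.prod_cons, List.prod_nil, List.sum_cons,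
    List.sum_nil, mul_one, add_zero, norm_neg, ← mul_assoc] at h
  rw [exp_zero_bracket]
  linarith

theorem exp_zero_add (A B : LieAlgebra.Orthogonal.so (Fin d) ℝ) :
    exp 0 (A + B) = exp 0 A * exp 0 B := by
  apply ext_apply
  · intro i
    simp [mul_π₁]
  · intro i j
    rw [mul_π₂]
    simp

theorem homNorm_exp_zero_sum_le {ι : Type*} (s : Finset ι)
    (F : ι → LieAlgebra.Orthogonal.so (Fin d) ℝ) :
    homNorm (exp 0 (∑ k ∈ s, F k)) ≤ ∑ k ∈ s, homNorm (exp 0 (F k)) := by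
  classical
  induction s using Finset.induction_on with
  | empty => exact homNorm_one_le (d := d)
  | insert k s hk ih =>
    rw [Finset.sum_insert hk, Finset.sum_insert hk, exp_zero_add]
    exact (homNorm_mul_le _ _).trans (by linarith)

/-- The factor `1 / 2` appears because each pair of indices is counted in both orders. Leaving the
factorisation `r k * r' k` free lets both letters later have length of order `√c`. -/
theorem π₂_eq_sum_bracket (A : LieAlgebra.Orthogonal.so (Fin d) ℝ)
    (r r' : Fin d × Fin d → ℝ)
    (hr : ∀ k, r k * r' k = (1 / 2 : ℝ) * (A : Matrix (Fin d) (Fin d) ℝ) k.1 k.2) :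
    A = ∑ k : Fin d × Fin d, bracket (r k • EuclideanSpace.single k.1 (1 : ℝ))
      (r' k • EuclideanSpace.single k.2 (1 : ℝ)) := by
  have hb : ∀ k, bracket (r k • EuclideanSpace.single k.1 (1 : ℝ))
      (r' k • EuclideanSpace.single k.2 (1 : ℝ)) =
      bracket (((1 / 2 : ℝ) * (A : Matrix (Fin d) (Fin d) ℝ) k.1 k.2) •
        EuclideanSpace.single k.1 (1 : ℝ)) (EuclideanSpace.single k.2 (1 : ℝ)) := by
    intro k
    apply Subtype.ext
    ext i j
    simp only [bracket_apply, PiLp.smul_apply, smul_eq_mul, ← hr k]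
    ring
  simp only [hb]
  apply Subtype.ext
  ext i j
  have hanti : (A : Matrix (Fin d) (Fin d) ℝ) j i = -(A : Matrix (Fin d) (Fin d) ℝ) i j := by
    have h := (LieAlgebra.Orthogonal.mem_so (Fin d) ℝ _).1 A.2
    exact congrFun (congrFun h i) j
  rw [AddSubmonoidClass.coe_finsetSum, Matrix.sum_apply, Fintype.sum_prod_type]
  simp only [bracket_apply, PiLp.smul_apply, PiLp.single_apply, smul_eq_mul,
    Finset.sum_sub_distrib]
  simp [mul_ite, ite_mul, Finset.sum_ite_eq, hanti]
  ring

/-- Splitting each coefficient evenly gives letters of length at most `√c`; each of the `d ^ 2`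
commutators then costs at most `4 * √c`. -/
theorem homNorm_exp_zero_so_le (A : LieAlgebra.Orthogonal.so (Fin d) ℝ) {c : ℝ}
    (hA : ∀ i j, |(A : Matrix (Fin d) (Fin d) ℝ) i j| ≤ c) :
    homNorm (exp 0 A) ≤ 4 * (d : ℝ) ^ 2 * √c := by
  have hr : ∀ k : Fin d × Fin d, ∃ r r' : ℝ,
      r * r' = (1 / 2 : ℝ) * (A : Matrix (Fin d) (Fin d) ℝ) k.1 k.2 ∧ |r| ≤ √c ∧ |r'| ≤ √c := by
    intro k
    set y := (A : Matrix (Fin d) (Fin d) ℝ) k.1 k.2 with hy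
    have hle : √|y| ≤ √c := Real.sqrt_le_sqrt (hA k.1 k.2)
    have hsq : √|y| * √|y| = |y| := Real.mul_self_sqrt (abs_nonneg _)
    have hnn := Real.sqrt_nonneg |y|
    rcases le_total 0 y with h | h
    · refine ⟨1 / 2 * √|y|, √|y|, ?_, ?_, ?_⟩
      · rw [abs_of_nonneg h] at hsq ⊢; linarith
      · rw [abs_of_nonneg (by positivity)]; linarith
      · rw [abs_of_nonneg hnn]; exact hle
    · refine ⟨-(1 / 2 * √|y|), √|y|, ?_, ?_, ?_⟩
      · rw [abs_of_nonpos h] at hsq ⊢; linarith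
      · rw [abs_neg, abs_of_nonneg (by positivity)]; linarith
      · rw [abs_of_nonneg hnn]; exact hle
  choose r r' h₁ h₂ h₃ using hr
  rw [π₂_eq_sum_bracket A r r' h₁]
  refine (homNorm_exp_zero_sum_le _ _).trans ?_
  refine (Finset.sum_le_card_nsmul _ _ (4 * √c) fun k _ => ?_).trans (le_of_eq ?_)
  · refine (homNorm_bracket_le _ _).trans ?_
    rw [norm_smul, norm_smul]
    simp only [PiLp.norm_single, norm_one, mul_one, Real.norm_eq_abs]
    linarith [h₂ k, h₃ k]
  · simp
    ring

theorem homNorm_le (g : StepTwoGroup d) {c : ℝ}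
    (hc : ∀ i j, |(g.π₂ : Matrix (Fin d) (Fin d) ℝ) i j| ≤ c) :
    homNorm g ≤ ‖g.π₁‖ + 4 * (d : ℝ) ^ 2 * √c := by
  have hg : g = exp g.π₁ 0 * exp 0 g.π₂ := by
    apply ext_apply
    · intro i
      simp [mul_π₁]
    · intro i j
      rw [mul_π₂]
      simp
  calc homNorm g = homNorm (exp g.π₁ 0 * exp 0 g.π₂) := by rw [← hg]
    _ ≤ _ := homNorm_mul_le _ _
    _ ≤ _ := add_le_add (homNorm_exp_zero_le _) (homNorm_exp_zero_so_le _ hc)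

theorem norm_π₁_prod_le (l : List (EuclideanSpace ℝ (Fin d))) :
    ‖(l.map fun v => exp v 0).prod.π₁‖ ≤ (l.map fun v => ‖v‖).sum := by
  induction l with
  | nil => exact norm_zero.le
  | cons v l ih =>
    simp only [List.map_cons, List.prod_cons, List.sum_cons]
    exact (norm_add_le v _).trans (by linarith)

theorem norm_π₁_le (g : StepTwoGroup d) : ‖g.π₁‖ ≤ homNorm g :=
  le_homNorm fun l hl => hl ▸ norm_π₁_prod_le l

theorem abs_π₁_le (g : StepTwoGroup d) (i : Fin d) : |g.π₁ i| ≤ homNorm g :=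
  (PiLp.norm_apply_le g.π₁ i).trans (norm_π₁_le g)

theorem abs_half_bracket_le (a b : EuclideanSpace ℝ (Fin d)) (i j : Fin d) :
    |(1 / 2 : ℝ) * (a i * b j - b i * a j)| ≤ ‖a‖ * ‖b‖ := by
  have h : ∀ k l, |a k * b l| ≤ ‖a‖ * ‖b‖ := fun k l => by
    rw [abs_mul]
    exact mul_le_mul (PiLp.norm_apply_le a k) (PiLp.norm_apply_le b l) (abs_nonneg _)
      (norm_nonneg _)
  have h₁ := abs_le.1 (h i j)
  have h₂ := abs_le.1 (h j i)
  rw [abs_le]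
  constructor <;> linarith [h₁.1, h₁.2, h₂.1, h₂.2]

/-- Prepending a letter `v` to a word of length `S` changes the second level by at most `‖v‖ * S`,
and `S ^ 2 + ‖v‖ * S ≤ (‖v‖ + S) ^ 2`. -/
theorem abs_π₂_prod_le (l : List (EuclideanSpace ℝ (Fin d))) (i j : Fin d) :
    |((l.map fun v => exp v 0).prod.π₂ : Matrix (Fin d) (Fin d) ℝ) i j| ≤
      (l.map fun v => ‖v‖).sum ^ 2 := by
  induction l with
  | nil => simp [one_π₂]
  | cons v l ih =>
    simp only [List.map_cons, List.prod_cons, List.sum_cons]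
    rw [mul_π₂]
    have h := abs_half_bracket_le v (l.map fun v => exp v 0).prod.π₁ i j
    have h' := norm_π₁_prod_le l
    have h₃ : ‖v‖ * ‖(l.map fun v => exp v 0).prod.π₁‖ ≤ ‖v‖ * (l.map fun v => ‖v‖).sum :=
      mul_le_mul_of_nonneg_left h' (norm_nonneg _)
    have h₄ : 0 ≤ ‖v‖ * (l.map fun v => ‖v‖).sum :=
      (mul_nonneg (norm_nonneg _) (norm_nonneg _)).trans h₃
    simp only [ZeroMemClass.coe_zero, Matrix.zero_apply, zero_add]
    refine (abs_add_le _ _).trans ((add_le_add ih (h.trans h₃)).trans ?_)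
    nlinarith [sq_nonneg ‖v‖]

/-- In square-root form the bound is linear in word length, so it passes to the infimum. -/
theorem abs_π₂_le (g : StepTwoGroup d) (i j : Fin d) :
    |(g.π₂ : Matrix (Fin d) (Fin d) ℝ) i j| ≤ homNorm g ^ 2 := by
  refine (Real.sqrt_le_left (homNorm_nonneg g)).1 (le_homNorm fun l hl => ?_)
  refine (Real.sqrt_le_left (List.sum_nonneg (by simp))).2 ?_
  exact hl ▸ abs_π₂_prod_le l i j

end StepTwoGroup

/-! ### Super-additive functions and sewing -/

/-- The constant `2 / (1 - 2 ^ (1 - θ))` of the sewing lemma. -/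
noncomputable def sewingConst (θ : ℝ) : ℝ := 2 / (1 - 2 * (1 / 2 : ℝ) ^ θ)

theorem two_mul_half_rpow_lt_one {θ : ℝ} (hθ : 1 < θ) : 2 * (1 / 2 : ℝ) ^ θ < 1 := by
  have := Real.rpow_lt_rpow_of_exponent_gt (x := (1 / 2 : ℝ)) (by norm_num) (by norm_num) hθ
  rw [Real.rpow_one] at this
  linarith

theorem sewingConst_pos {θ : ℝ} (hθ : 1 < θ) : 0 < sewingConst θ :=
  div_pos two_pos (sub_pos.2 (two_mul_half_rpow_lt_one hθ))

/-- This fixed-point equation closes the induction of the maximal inequality: two halves, each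
scaled by `(1 / 2) ^ θ`, plus two defects. -/
theorem sewingConst_eq {θ : ℝ} (hθ : 1 < θ) :
    sewingConst θ = 2 * (sewingConst θ * (1 / 2 : ℝ) ^ θ) + 2 := by
  have := (sub_pos.2 (two_mul_half_rpow_lt_one hθ)).ne'
  unfold sewingConst
  field_simp
  ring

/-- `Ω` is nonnegative and super-additive on `{0 ≤ u ≤ v ≤ 1}`. -/
structure IsSuperadditive (Ω : ℝ → ℝ → ℝ) : Prop where
  nonneg : ∀ u v, 0 ≤ u → u ≤ v → v ≤ 1 → 0 ≤ Ω u v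
  add_le : ∀ u m v, 0 ≤ u → u ≤ m → m ≤ v → v ≤ 1 → Ω u m + Ω m v ≤ Ω u v

namespace IsSuperadditive

variable {Ω : ℝ → ℝ → ℝ}

theorem self_eq_zero (h : IsSuperadditive Ω) {u : ℝ} (h₀ : 0 ≤ u) (h₁ : u ≤ 1) : Ω u u = 0 := by
  linarith [h.add_le u u u h₀ le_rfl le_rfl h₁, h.nonneg u u h₀ le_rfl h₁]

theorem mono (h : IsSuperadditive Ω) {u u' v' v : ℝ} (h₀ : 0 ≤ u) (hu : u ≤ u') (huv : u' ≤ v')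
    (hv : v' ≤ v) (h₁ : v ≤ 1) : Ω u' v' ≤ Ω u v := by
  linarith [h.add_le u u' v h₀ hu (huv.trans hv) h₁,
    h.add_le u' v' v (h₀.trans hu) huv hv h₁,
    h.nonneg u u' h₀ hu (huv.trans (hv.trans h₁)),
    h.nonneg v' v (h₀.trans (hu.trans huv)) hv h₁]

theorem sum_le (h : IsSuperadditive Ω) {τ : ℕ → ℝ} {n : ℕ} (hτ : ∀ i < n, τ i ≤ τ (i + 1))
    (h₀ : 0 ≤ τ 0) (h₁ : τ n ≤ 1) :
    τ 0 ≤ τ n ∧ ∑ i ∈ Finset.range n, Ω (τ i) (τ (i + 1)) ≤ Ω (τ 0) (τ n) := by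
  induction n with
  | zero => exact ⟨le_rfl, by simpa using h.nonneg _ _ h₀ le_rfl h₁⟩
  | succ n ih =>
    have hn := hτ n n.lt_succ_self
    obtain ⟨h₂, h₃⟩ := ih (fun i hi => hτ i (hi.trans n.lt_succ_self)) (hn.trans h₁)
    refine ⟨h₂.trans hn, ?_⟩
    rw [Finset.sum_range_succ]
    linarith [h.add_le _ _ _ h₀ h₂ hn h₁]

/-- Young's maximal inequality along a finite sequence. -/
theorem abs_sum_sub_le (h : IsSuperadditive Ω) {A : ℝ → ℝ → ℝ} {M θ : ℝ} (hθ : 1 < θ)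
    (hM : 0 ≤ M) (hA₀ : ∀ u, A u u = 0)
    (hA : ∀ u m v, 0 ≤ u → u ≤ m → m ≤ v → v ≤ 1 → |A u v - A u m - A m v| ≤ M * Ω u v ^ θ)
    {τ : ℕ → ℝ} (hτ : Monotone τ) (hmem : ∀ i, τ i ∈ Icc (0 : ℝ) 1) (i k : ℕ) (hik : i ≤ k) :
    |∑ l ∈ Finset.Ico i k, A (τ l) (τ (l + 1)) - A (τ i) (τ k)| ≤
      sewingConst θ * M * Ω (τ i) (τ k) ^ θ := by
  induction hn : k - i using Nat.strong_induction_on generalizing i k with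
  | _ n ih =>
  have hnn : ∀ i k, i ≤ k → 0 ≤ Ω (τ i) (τ k) := fun i k hik =>
    h.nonneg _ _ (hmem i).1 (hτ hik) (hmem k).2
  have hK := sewingConst_pos hθ
  rcases hik.eq_or_lt with rfl | hlt
  · have := Real.rpow_nonneg (hnn i i le_rfl) θ
    simpa [hA₀] using by positivity
  classical
  set w := Ω (τ i) (τ k) with hw
  have hw₀ : 0 ≤ w := hnn i k hik
  -- Halve by `Ω` rather than by length: take the last `j < k` with at most half of `w` on its left.
  -- By super-additivity at most half lies right of `j + 1`, and the single step from `j` to `j + 1`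
  -- needs no estimate.
  let P : ℕ → Prop := fun j => Ω (τ i) (τ (i + j)) ≤ w / 2 ∧ i + j < k
  have hP₀ : P 0 := ⟨by
    rw [add_zero, h.self_eq_zero (hmem i).1 (hmem i).2]; positivity, by simpa using hlt⟩
  set j₀ := Nat.findGreatest P k with hj₀
  have hPj : P j₀ := Nat.findGreatest_spec (Nat.zero_le k) hP₀
  set j := i + j₀ with hj
  have hij : i ≤ j := Nat.le_add_right _ _
  have hjk : j + 1 ≤ k := hPj.2
  have hleft : Ω (τ i) (τ j) ≤ w / 2 := hPj.1
  have hright : Ω (τ (j + 1)) (τ k) ≤ w / 2 := by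
    rcases hjk.eq_or_lt with he | hl
    · rw [he, h.self_eq_zero (hmem k).1 (hmem k).2]; positivity
    · have hnot : ¬ P (j₀ + 1) :=
        Nat.findGreatest_is_greatest (Nat.lt_succ_self j₀) (by omega)
      have hgt : w / 2 < Ω (τ i) (τ (j + 1)) := by
        by_contra hcon
        exact hnot ⟨not_lt.1 hcon, hl⟩
      linarith [h.add_le (τ i) (τ (j + 1)) (τ k) (hmem i).1 (hτ (by omega)) (hτ hjk) (hmem k).2]
  have e₁ := ih (j - i) (by omega) i j hij rfl
  have e₂ := ih (k - (j + 1)) (by omega) (j + 1) k hjk rfl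
  have hhalf : ∀ y, 0 ≤ y → y ≤ w / 2 →
      sewingConst θ * M * y ^ θ ≤ sewingConst θ * (1 / 2 : ℝ) ^ θ * (M * w ^ θ) := by
    intro y hy hyw
    have : y ^ θ ≤ (1 / 2 : ℝ) ^ θ * w ^ θ := by
      rw [← Real.mul_rpow (by norm_num) hw₀]
      exact Real.rpow_le_rpow hy (by linarith) (by linarith)
    calc sewingConst θ * M * y ^ θ ≤ sewingConst θ * M * ((1 / 2 : ℝ) ^ θ * w ^ θ) := by gcongr
      _ = _ := by ring
  have e₁' := e₁.trans (hhalf _ (hnn i j hij) hleft)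
  have e₂' := e₂.trans (hhalf _ (hnn (j + 1) k hjk) hright)
  have d₁ := hA (τ i) (τ j) (τ k) (hmem i).1 (hτ hij) (hτ (by omega)) (hmem k).2
  have d₂ := hA (τ j) (τ (j + 1)) (τ k) (hmem j).1 (hτ (by omega)) (hτ hjk) (hmem k).2
  have d₂' : M * Ω (τ j) (τ k) ^ θ ≤ M * w ^ θ := by
    have := h.mono (hmem i).1 (hτ hij) (hτ (by omega : j ≤ k)) le_rfl (hmem k).2
    have := Real.rpow_le_rpow (hnn j k (by omega)) this (by linarith : 0 ≤ θ)
    gcongr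
  have hsum : ∑ l ∈ Finset.Ico i k, A (τ l) (τ (l + 1)) =
      ∑ l ∈ Finset.Ico i j, A (τ l) (τ (l + 1)) + A (τ j) (τ (j + 1)) +
        ∑ l ∈ Finset.Ico (j + 1) k, A (τ l) (τ (l + 1)) := by
    rw [← Finset.sum_Ico_consecutive _ hij (by omega : j ≤ k),
      Finset.sum_eq_sum_Ico_succ_bot (by omega : j < k)]
    exact (add_assoc _ _ _).symm
  have hfin : sewingConst θ * M * w ^ θ =
      2 * (sewingConst θ * (1 / 2 : ℝ) ^ θ * (M * w ^ θ)) + 2 * (M * w ^ θ) := by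
    have := congrArg (· * (M * w ^ θ)) (sewingConst_eq hθ)
    rw [add_mul] at this
    linarith
  rw [hsum, hfin]
  have d₂'' := d₂.trans d₂'
  rw [abs_le] at e₁' e₂' d₁ d₂'' ⊢
  constructor <;> linarith [e₁'.1, e₁'.2, e₂'.1, e₂'.2, d₁.1, d₁.2, d₂''.1, d₂''.2]

/-- On a finite set, sums of `A` over consecutive points already provide `φ`; the maximal inequality
makes the bound independent of the set. -/
theorem exists_sewing_finset (h : IsSuperadditive Ω) {A : ℝ → ℝ → ℝ} {M θ : ℝ} (hθ : 1 < θ)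
    (hM : 0 ≤ M) (hA₀ : ∀ u, A u u = 0)
    (hA : ∀ u m v, 0 ≤ u → u ≤ m → m ≤ v → v ≤ 1 → |A u v - A u m - A m v| ≤ M * Ω u v ^ θ)
    (F : Finset ℝ) :
    ∃ φ : ℝ → ℝ, ∀ u ∈ F, ∀ v ∈ F, 0 ≤ u → u ≤ v → v ≤ 1 →
      |φ v - φ u - A u v| ≤ sewingConst θ * M * Ω u v ^ θ := by
  classical
  wlog hF : ∀ u ∈ F, u ∈ Icc (0 : ℝ) 1 generalizing F
  · obtain ⟨φ, hφ⟩ := this (F.filter (· ∈ Icc (0 : ℝ) 1)) (fun u hu => (Finset.mem_filter.1 hu).2)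
    refine ⟨φ, fun u hu v hv h₀ huv h₁ => hφ u ?_ v ?_ h₀ huv h₁⟩
    · exact Finset.mem_filter.2 ⟨hu, h₀, huv.trans h₁⟩
    · exact Finset.mem_filter.2 ⟨hv, h₀.trans huv, h₁⟩
  rcases F.eq_empty_or_nonempty with rfl | hne
  · exact ⟨0, by simp⟩
  have hcard : 0 < F.card := hne.card_pos
  let e := F.orderIsoOfFin rfl
  -- Truncating the index keeps `τ` monotone on all of `ℕ`, constant after the last point.
  let τ : ℕ → ℝ := fun i => e ⟨min i (F.card - 1), by omega⟩
  have hτ : Monotone τ := by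
    intro i j hij
    refine e.monotone ?_
    rw [Fin.mk_le_mk]
    omega
  have hmem : ∀ i, τ i ∈ Icc (0 : ℝ) 1 := fun i => hF _ (Subtype.coe_prop _)
  let idx : ℝ → ℕ := fun u => if hu : u ∈ F then (e.symm ⟨u, hu⟩ : ℕ) else 0
  have hidx : ∀ u ∈ F, τ (idx u) = u := by
    intro u hu
    have hlt := (e.symm ⟨u, hu⟩).2
    have : (⟨min (idx u) (F.card - 1), by omega⟩ : Fin F.card) = e.symm ⟨u, hu⟩ := by
      apply Fin.ext
      simp only [idx, dif_pos hu]
      omega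
    simp only [τ, this, OrderIso.apply_symm_apply]
  refine ⟨fun u => ∑ l ∈ Finset.range (idx u), A (τ l) (τ (l + 1)), ?_⟩
  intro u hu v hv h₀ huv h₁
  have hle : idx u ≤ idx v := by
    simp only [idx, dif_pos hu, dif_pos hv]
    exact e.symm.monotone (show (⟨u, hu⟩ : F) ≤ ⟨v, hv⟩ from huv)
  have := h.abs_sum_sub_le hθ hM hA₀ hA hτ hmem (idx u) (idx v) hle
  rw [hidx u hu, hidx v hv, Finset.sum_Ico_eq_sub _ hle] at this
  exact this

/-- The sewing lemma for a super-additive function. -/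
theorem exists_sewing (h : IsSuperadditive Ω) {A : ℝ → ℝ → ℝ} {M θ : ℝ} (hθ : 1 < θ)
    (hM : 0 ≤ M) (hA₀ : ∀ u, A u u = 0)
    (hA : ∀ u m v, 0 ≤ u → u ≤ m → m ≤ v → v ≤ 1 → |A u v - A u m - A m v| ≤ M * Ω u v ^ θ) :
    ∃ φ : ℝ → ℝ, ∀ u v, 0 ≤ u → u ≤ v → v ≤ 1 →
      |φ v - φ u - A u v| ≤ sewingConst θ * M * Ω u v ^ θ := by
  classical
  choose φ hφ using h.exists_sewing_finset hθ hM hA₀ hA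
  -- The `φ F` need not be compatible. Normalised at `0`, their values at a given point eventually
  -- stay in a compact interval, so they converge along an ultrafilter; each two-point estimate
  -- holds eventually and survives the limit.
  let U : Ultrafilter (Finset ℝ) := Ultrafilter.of Filter.atTop
  have hU : ∀ u : ℝ, ∀ᶠ F in (U : Filter (Finset ℝ)), u ∈ F := fun u =>
    Ultrafilter.of_le Filter.atTop
      ((Filter.eventually_ge_atTop {u}).mono fun F hF => by simpa using hF)
  have hlim : ∀ v : ℝ, ∃ y : ℝ, v ∈ Icc (0 : ℝ) 1 →
      Filter.Tendsto (fun F => φ F v - φ F 0) (U : Filter (Finset ℝ)) (nhds y) := by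
    intro v
    by_cases hv : v ∈ Icc (0 : ℝ) 1
    · set c := sewingConst θ * M * Ω 0 v ^ θ with hc
      have hcomp : IsCompact (Icc (A 0 v - c) (A 0 v + c)) := isCompact_Icc
      have hev : ∀ᶠ F in (U : Filter (Finset ℝ)),
          φ F v - φ F 0 ∈ Icc (A 0 v - c) (A 0 v + c) := by
        filter_upwards [hU 0, hU v] with F h₀ h₁
        have := abs_le.1 (hφ F 0 h₀ v h₁ le_rfl hv.1 hv.2)
        exact ⟨by linarith [this.1], by linarith [this.2]⟩
      obtain ⟨y, -, hy⟩ := hcomp.ultrafilter_le_nhds' (U.map fun F => φ F v - φ F 0) hev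
      exact ⟨y, fun _ => hy⟩
    · exact ⟨0, fun hv' => absurd hv' hv⟩
  choose ψ hψ using hlim
  refine ⟨ψ, fun u v h₀ huv h₁ => ?_⟩
  have ht := ((hψ v ⟨h₀.trans huv, h₁⟩).sub (hψ u ⟨h₀, huv.trans h₁⟩)).sub_const (A u v)
  refine le_of_tendsto ht.abs ?_
  filter_upwards [hU u, hU v] with F hu hv
  have := hφ F u hu v hv h₀ huv h₁
  rwa [sub_sub_sub_cancel_right]

end IsSuperadditive

/-! ### Controls and their geometric means -/

theorem IsControl.isSuperadditive {ω : ℝ → ℝ → ℝ} (h : IsControl ω) : IsSuperadditive ω :=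
  ⟨h.nonneg, h.superadditive⟩

/-- A control is uniformly small near the diagonal. -/
theorem IsControl.exists_forall_lt {ω : ℝ → ℝ → ℝ} (h : IsControl ω) {η : ℝ} (hη : 0 < η) :
    ∃ δ > 0, ∀ u v, 0 ≤ u → u ≤ v → v ≤ 1 → v - u < δ → ω u v < η := by
  obtain ⟨δ, hδ, hc⟩ := h.continuous_near_diagonal
  -- A compact strip inside the region of continuity; uniform continuity there compares `(u, v)`
  -- with `(u, u)`.
  set K : Set (ℝ × ℝ) := {z | 0 ≤ z.1 ∧ z.1 ≤ z.2 ∧ z.2 ≤ 1 ∧ z.2 - z.1 ≤ δ / 2} with hK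
  have hKc : IsCompact K := by
    refine (isCompact_Icc (a := ((0 : ℝ), (0 : ℝ))) (b := (1, 1))).of_isClosed_subset ?_ ?_
    · refine IsClosed.inter (isClosed_le continuous_const continuous_fst) (IsClosed.inter
        (isClosed_le continuous_fst continuous_snd) (IsClosed.inter
        (isClosed_le continuous_snd continuous_const)
        (isClosed_le (continuous_snd.sub continuous_fst) continuous_const)))
    · rintro ⟨u, v⟩ ⟨h₁, h₂, h₃, -⟩
      exact ⟨⟨h₁, h₁.trans h₂⟩, ⟨h₂.trans h₃, h₃⟩⟩
  have hu := hKc.uniformContinuousOn_of_continuous (hc.mono fun z hz =>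
    ⟨hz.1, hz.2.1, hz.2.2.1, hz.2.2.2.trans_lt (half_lt_self hδ)⟩)
  rw [Metric.uniformContinuousOn_iff] at hu
  obtain ⟨δ', hδ', H⟩ := hu η hη
  refine ⟨min (δ / 2) δ', lt_min (half_pos hδ) hδ', fun u v h₀ huv h₁ hlt => ?_⟩
  have hz : (u, v) ∈ K := ⟨h₀, huv, h₁, (hlt.trans_le (min_le_left _ _)).le⟩
  have hz' : (u, u) ∈ K := ⟨h₀, le_rfl, huv.trans h₁, by simpa using (half_pos hδ).le⟩
  have := H _ hz _ hz' (by
    rw [Prod.dist_eq, dist_self, Real.dist_eq, abs_of_nonneg (sub_nonneg.2 huv)]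
    exact max_lt hδ' (hlt.trans_le (min_le_right _ _)))
  rw [Real.dist_eq, h.diagonal u h₀ (huv.trans h₁), sub_zero] at this
  exact (le_abs_self _).trans_lt this

/-- Hölder's inequality on two points, with exponents `1 / α` and `1 / β`. -/
theorem add_rpow_mul_rpow_le {x y x' y' α β : ℝ} (hx : 0 ≤ x) (hy : 0 ≤ y) (hx' : 0 ≤ x')
    (hy' : 0 ≤ y') (hα : 0 < α) (hβ : 0 < β) (hαβ : α + β = 1) :
    x ^ α * y ^ β + x' ^ α * y' ^ β ≤ (x + x') ^ α * (y + y') ^ β := by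
  have hc : (1 / α).HolderConjugate (1 / β) :=
    Real.holderConjugate_iff.2 ⟨by rw [lt_div_iff₀ hα]; linarith, by simpa using hαβ⟩
  have := Real.inner_le_Lp_mul_Lq_of_nonneg (Finset.univ : Finset (Fin 2)) hc
    (f := ![x ^ α, x' ^ α]) (g := ![y ^ β, y' ^ β])
    (by intro i _; fin_cases i <;> simp <;> positivity)
    (by intro i _; fin_cases i <;> simp <;> positivity)
  simpa [Fin.sum_univ_two, Real.rpow_rpow_inv, hx, hx', hy, hy', hα.ne', hβ.ne'] using this

/-- This merges the controls of integrand and integrator into one super-additive function, as sewing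
requires. -/
theorem IsSuperadditive.rpow_mul_rpow {κ ω : ℝ → ℝ → ℝ} (hκ : IsSuperadditive κ)
    (hω : IsSuperadditive ω) {α β : ℝ} (hα : 0 < α) (hβ : 0 < β) (hαβ : α + β = 1) :
    IsSuperadditive fun u v => κ u v ^ α * ω u v ^ β := by
  refine ⟨fun u v h₀ huv h₁ => mul_nonneg (Real.rpow_nonneg (hκ.nonneg u v h₀ huv h₁) _)
    (Real.rpow_nonneg (hω.nonneg u v h₀ huv h₁) _), fun u m v h₀ hum hmv h₁ => ?_⟩
  have k₁ := hκ.nonneg u m h₀ hum (hmv.trans h₁)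
  have k₂ := hκ.nonneg m v (h₀.trans hum) hmv h₁
  have w₁ := hω.nonneg u m h₀ hum (hmv.trans h₁)
  have w₂ := hω.nonneg m v (h₀.trans hum) hmv h₁
  refine (add_rpow_mul_rpow_le k₁ w₁ k₂ w₂ hα hβ hαβ).trans ?_
  exact mul_le_mul
    (Real.rpow_le_rpow (add_nonneg k₁ k₂) (hκ.add_le u m v h₀ hum hmv h₁) hα.le)
    (Real.rpow_le_rpow (add_nonneg w₁ w₂) (hω.add_le u m v h₀ hum hmv h₁) hβ.le)
    (Real.rpow_nonneg (add_nonneg w₁ w₂) _)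
    (Real.rpow_nonneg (hκ.nonneg u v h₀ (hum.trans hmv) h₁) _)

/-! ### Young integration -/

/-- Existence of the integral, and Young's estimate, for a super-additive function `Ω` that is
uniformly small near the diagonal. -/
theorem IsSuperadditive.exists_hasYoungIntegral {Ω : ℝ → ℝ → ℝ} (h : IsSuperadditive Ω)
    (hsmall : ∀ η > 0, ∃ δ > 0, ∀ u v, 0 ≤ u → u ≤ v → v ≤ 1 → v - u < δ → Ω u v < η)
    {M θ : ℝ} (hθ : 1 < θ) (hM : 0 ≤ M) {a b : ℝ → ℝ}
    (hab : ∀ u m m' v, 0 ≤ u → u ≤ m → m ≤ v → u ≤ m' → m' ≤ v → v ≤ 1 →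
      |(a m - a u) * (b v - b m')| ≤ M * Ω u v ^ θ)
    {s t : ℝ} (hs : 0 ≤ s) (hst : s ≤ t) (ht : t ≤ 1) :
    ∃ I, HasYoungIntegral a b s t I ∧
      |I - a s * (b t - b s)| ≤ sewingConst θ * M * Ω s t ^ θ := by
  -- The defect of this germ at `m` is `-(a m - a u) * (b v - b m)`.
  obtain ⟨φ, hφ⟩ := h.exists_sewing (A := fun u v => a u * (b v - b u)) hθ hM (by simp)
    (fun u m v h₀ hum hmv h₁ => by
      have := hab u m m v h₀ hum hmv hum hmv h₁
      rw [← abs_neg] at this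
      convert this using 2
      ring)
  refine ⟨φ t - φ s, fun η hη => ?_, hφ s t hs hst ht⟩
  have hK := sewingConst_pos hθ
  have hw : 0 ≤ Ω s t := h.nonneg s t hs hst ht
  set c := (1 + sewingConst θ) * M with hc
  have hc₀ : 0 ≤ c := by positivity
  -- Once `Ω ≤ ρ ^ (1 / (θ - 1))` on each interval, `Ω ^ θ ≤ ρ * Ω` there, and the errors sum to at
  -- most `c * ρ * Ω s t < η`. The `1` avoids a zero denominator and makes the last inequality
  -- strict.
  set ρ := η / (c * Ω s t + 1) with hρ
  have hρ₀ : 0 < ρ := by positivity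
  have hθ' : 0 < θ - 1 := sub_pos.2 hθ
  obtain ⟨δ, hδ, H⟩ := hsmall (ρ ^ (1 / (θ - 1))) (Real.rpow_pos_of_pos hρ₀ _)
  refine ⟨δ, hδ, fun n τ ξ hτ₀ hτn hτ => ?_⟩
  have hτ' : ∀ i < n, τ i ≤ τ (i + 1) := fun i hi => (hτ i hi).1.trans (hτ i hi).2.1
  have hmono : ∀ i ≤ n, s ≤ τ i := by
    intro i
    induction i with
    | zero => exact fun _ => hτ₀.ge
    | succ i ih => exact fun hi => (ih (by omega)).trans (hτ' i (by omega))
  have hmono' : ∀ i ≤ n, τ i ≤ t := by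
    intro i hi
    induction hi using Nat.decreasingInduction with
    | self => exact hτn.le
    | of_succ k hk ih => exact (hτ' k hk).trans ih
  have hterm : ∀ i < n, |a (ξ i) * (b (τ (i + 1)) - b (τ i)) - (φ (τ (i + 1)) - φ (τ i))| ≤
      c * ρ * Ω (τ i) (τ (i + 1)) := by
    intro i hi
    have l₀ : 0 ≤ τ i := hs.trans (hmono i hi.le)
    have l₁ : τ (i + 1) ≤ 1 := (hmono' (i + 1) hi).trans ht
    obtain ⟨x₁, x₂, x₃⟩ := hτ i hi
    have e₁ := abs_le.1 (hφ _ _ l₀ (hτ' i hi) l₁)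
    -- The cost of moving the tag from the left endpoint to `ξ i`: here the integrator's increment
    -- spans the whole interval, whence the separate `m'` in `hab`.
    have e₂ := abs_le.1 (hab (τ i) (ξ i) (τ i) (τ (i + 1)) l₀ x₁ x₂ le_rfl (hτ' i hi) l₁)
    set y := Ω (τ i) (τ (i + 1)) with hy
    have hy₀ : 0 ≤ y := h.nonneg _ _ l₀ (hτ' i hi) l₁
    have hyρ : y ^ (θ - 1) ≤ ρ := by
      have := Real.rpow_le_rpow hy₀ (H _ _ l₀ (hτ' i hi) l₁ x₃).le hθ'.le
      rwa [← Real.rpow_mul hρ₀.le, one_div_mul_cancel hθ'.ne', Real.rpow_one] at this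
    have hyθ : y ^ θ ≤ ρ * y := by
      rcases hy₀.eq_or_lt with h0 | h0
      · rw [← h0, Real.zero_rpow (by linarith), mul_zero]
      · have : y ^ θ = y ^ (θ - 1) * y := by
          rw [← Real.rpow_add_one h0.ne', sub_add_cancel]
        rw [this]
        gcongr
    have : c * y ^ θ ≤ c * ρ * y := by
      rw [mul_assoc c ρ y]
      exact mul_le_mul_of_nonneg_left hyθ hc₀
    refine le_trans ?_ this
    rw [abs_le, hc]
    constructor <;> linarith [e₁.1, e₁.2, e₂.1, e₂.2]
  have htel : φ t - φ s = ∑ i ∈ Finset.range n, (φ (τ (i + 1)) - φ (τ i)) := by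
    rw [Finset.sum_range_sub (fun i => φ (τ i)), hτ₀, hτn]
  have hsum := (h.sum_le hτ' (hτ₀.symm ▸ hs) (hτn.symm ▸ ht)).2
  rw [hτ₀, hτn] at hsum
  rw [htel, ← Finset.sum_sub_distrib]
  calc _ ≤ ∑ i ∈ Finset.range n, c * ρ * Ω (τ i) (τ (i + 1)) :=
        (Finset.abs_sum_le_sum_abs _ _).trans
          (Finset.sum_le_sum fun i hi => hterm i (Finset.mem_range.1 hi))
    _ = c * ρ * ∑ i ∈ Finset.range n, Ω (τ i) (τ (i + 1)) := (Finset.mul_sum _ _ _).symm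
    _ ≤ c * ρ * Ω s t := by gcongr
    _ = η * (c * Ω s t / (c * Ω s t + 1)) := by rw [hρ]; ring
    _ < η := by
      have hpos : 0 < c * Ω s t + 1 := by positivity
      have : c * Ω s t / (c * Ω s t + 1) < 1 := (div_lt_one hpos).2 (by linarith)
      nlinarith

/-- Young's theorem: `∫ a db` exists if `a` and `b` have finite `q`- and `p`-variation with
`1 / q + 1 / p > 1`. -/
theorem exists_hasYoungIntegral {κ ω : ℝ → ℝ → ℝ} (hκ : IsControl κ) (hω : IsControl ω)
    {p q M : ℝ} (hp : 0 < p) (hq : 0 < q) (hpq : 1 < 1 / q + 1 / p) (hM : 0 ≤ M)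
    {a b : ℝ → ℝ}
    (hab : ∀ u m m' v, 0 ≤ u → u ≤ m → m ≤ v → u ≤ m' → m' ≤ v → v ≤ 1 →
      |(a m - a u) * (b v - b m')| ≤ M * (κ u v ^ (1 / q) * ω u v ^ (1 / p)))
    {s t : ℝ} (hs : 0 ≤ s) (hst : s ≤ t) (ht : t ≤ 1) :
    ∃ I, HasYoungIntegral a b s t I ∧ |I - a s * (b t - b s)| ≤
      sewingConst (1 / q + 1 / p) * M * (κ s t ^ (1 / q) * ω s t ^ (1 / p)) := by
  set θ := 1 / q + 1 / p with hθ
  have hθ₀ : 0 < θ := by linarith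
  -- Normalised to `α + β = 1`, so that the mean is super-additive and its `θ`-th power is the
  -- original product.
  set α := 1 / q / θ with hα
  set β := 1 / p / θ with hβ
  have hα₀ : 0 < α := by positivity
  have hβ₀ : 0 < β := by positivity
  have hαβ : α + β = 1 := by rw [hα, hβ, ← add_div, ← hθ, div_self hθ₀.ne']
  have hΩ := hκ.isSuperadditive.rpow_mul_rpow hω.isSuperadditive hα₀ hβ₀ hαβ
  have hpow : ∀ u v, 0 ≤ u → u ≤ v → v ≤ 1 →
      (κ u v ^ α * ω u v ^ β) ^ θ = κ u v ^ (1 / q) * ω u v ^ (1 / p) := by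
    intro u v h₀ huv h₁
    have k := hκ.nonneg u v h₀ huv h₁
    have w := hω.nonneg u v h₀ huv h₁
    rw [Real.mul_rpow (by positivity) (by positivity), ← Real.rpow_mul k, ← Real.rpow_mul w,
      hα, hβ, div_mul_cancel₀ _ hθ₀.ne', div_mul_cancel₀ _ hθ₀.ne']
  have hsmall : ∀ η > 0, ∃ δ > 0, ∀ u v, 0 ≤ u → u ≤ v → v ≤ 1 → v - u < δ →
      κ u v ^ α * ω u v ^ β < η := by
    intro η hη
    obtain ⟨δ₁, h₁, H₁⟩ := hκ.exists_forall_lt hη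
    obtain ⟨δ₂, h₂, H₂⟩ := hω.exists_forall_lt hη
    refine ⟨min δ₁ δ₂, lt_min h₁ h₂, fun u v h₀ huv h₁ hlt => ?_⟩
    have k := hκ.nonneg u v h₀ huv h₁
    have w := hω.nonneg u v h₀ huv h₁
    have k' := Real.rpow_lt_rpow k (H₁ u v h₀ huv h₁ (hlt.trans_le (min_le_left _ _))) hα₀
    have w' := Real.rpow_lt_rpow w (H₂ u v h₀ huv h₁ (hlt.trans_le (min_le_right _ _))) hβ₀
    calc κ u v ^ α * ω u v ^ β < η ^ α * η ^ β :=
          mul_lt_mul'' k' w' (by positivity) (by positivity)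
      _ = η := by rw [← Real.rpow_add hη, hαβ, Real.rpow_one]
  obtain ⟨I, hI, hb⟩ := hΩ.exists_hasYoungIntegral hsmall hpq hM (a := a) (b := b)
    (fun u m m' v h₀ h₁ h₂ h₃ h₄ h₅ => by
      rw [hpow u v h₀ (h₁.trans h₂) h₅]
      exact hab u m m' v h₀ h₁ h₂ h₃ h₄ h₅) hs hst ht
  refine ⟨I, hI, ?_⟩
  rwa [hpow s t hs hst ht] at hb

theorem HasYoungIntegral.youngIntegral_eq {a b : ℝ → ℝ} {s t I : ℝ}
    (h : HasYoungIntegral a b s t I) (hst : s ≤ t) : youngIntegral a b s t = I := by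
  have hI : YoungIntegrable a b s t := ⟨I, h⟩
  rw [youngIntegral, dif_pos hI]
  exact hI.choose_spec.unique hst h

/-! ### Increments and the translated path -/

namespace StepTwoGroup

variable {d : ℕ}

theorem incr_π₁ (x : ℝ → StepTwoGroup d) (s t : ℝ) (i : Fin d) :
    (incr x s t).π₁ i = (x t).π₁ i - (x s).π₁ i := by
  rw [incr, mul_π₁, inv_π₁]
  ring

theorem homNorm_incr_le {x : ℝ → StepTwoGroup d} {ω : ℝ → ℝ → ℝ} {p ε : ℝ} (hp : 0 < p)
    (hε : 0 ≤ ε) (hω : IsControl ω)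
    (h : VariationControlledBy p (fun s t => ε ^ p * ω s t) x) {s t : ℝ} (hs : 0 ≤ s)
    (hst : s ≤ t) (ht : t ≤ 1) : homNorm (incr x s t) ≤ ε * ω s t ^ (1 / p) := by
  have w := hω.nonneg s t hs hst ht
  have := Real.rpow_le_rpow (Real.rpow_nonneg (homNorm_nonneg _) _) (h s t hs hst ht)
    (one_div_pos.2 hp).le
  rwa [← Real.rpow_mul (homNorm_nonneg _), Real.mul_rpow (by positivity) w, ← Real.rpow_mul hε,
    mul_one_div_cancel hp.ne', Real.rpow_one, Real.rpow_one] at this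

/-- Young's estimate for the first levels of two paths of finite variation. -/
theorem exists_hasYoungIntegral_incr {y z : ℝ → StepTwoGroup d} {κ ω : ℝ → ℝ → ℝ}
    (hκ : IsControl κ) (hω : IsControl ω) {p q k l : ℝ} (hp : 0 < p) (hq : 0 < q)
    (hpq : 1 < 1 / q + 1 / p) (hk : 0 ≤ k) (hl : 0 ≤ l)
    (hy : ∀ s t, 0 ≤ s → s ≤ t → t ≤ 1 → homNorm (incr y s t) ≤ k * κ s t ^ (1 / q))
    (hz : ∀ s t, 0 ≤ s → s ≤ t → t ≤ 1 → homNorm (incr z s t) ≤ l * ω s t ^ (1 / p))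
    {s t : ℝ} (hs : 0 ≤ s) (hst : s ≤ t) (ht : t ≤ 1) (i j : Fin d) :
    ∃ I, HasYoungIntegral (fun u => (incr y s u).π₁ i) (fun u => (z u).π₁ j) s t I ∧
      |I| ≤ sewingConst (1 / q + 1 / p) * (k * l) * (κ s t ^ (1 / q) * ω s t ^ (1 / p)) := by
  obtain ⟨I, hI, hb⟩ := exists_hasYoungIntegral hκ hω hp hq hpq (mul_nonneg hk hl)
    (a := fun u => (incr y s u).π₁ i) (b := fun u => (z u).π₁ j)
    (fun u m m' v h₀ h₁ h₂ h₃ h₄ h₅ => by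
      have e₁ := (abs_π₁_le (incr y u m) i).trans (hy u m h₀ h₁ (h₂.trans h₅))
      have e₂ := (abs_π₁_le (incr z m' v) j).trans (hz m' v (h₀.trans h₃) h₄ h₅)
      rw [incr_π₁] at e₁ e₂
      have f₁ : κ u m ^ (1 / q) ≤ κ u v ^ (1 / q) :=
        Real.rpow_le_rpow (hκ.nonneg u m h₀ h₁ (h₂.trans h₅))
          (hκ.isSuperadditive.mono h₀ le_rfl h₁ h₂ h₅) (by positivity)
      have f₂ : ω m' v ^ (1 / p) ≤ ω u v ^ (1 / p) :=
        Real.rpow_le_rpow (hω.nonneg m' v (h₀.trans h₃) h₄ h₅)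
          (hω.isSuperadditive.mono h₀ h₃ h₄ le_rfl h₅) (by positivity)
      have g₁ := e₁.trans (mul_le_mul_of_nonneg_left f₁ hk)
      have g₂ := e₂.trans (mul_le_mul_of_nonneg_left f₂ hl)
      rw [incr_π₁, incr_π₁, sub_sub_sub_cancel_right, abs_mul]
      refine (mul_le_mul g₁ g₂ (abs_nonneg _) ((abs_nonneg _).trans g₁)).trans (le_of_eq ?_)
      ring) hs hst ht
  refine ⟨I, hI, ?_⟩
  -- The integrand vanishes at `s`, so the first-order term `a s * (b t - b s)` disappears.
  simpa [incr_π₁] using hb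

/-- The second level is central, so that of `f` cancels; the product correction is the bracket of
`-f` with `f + x`, in which the bracket of `f` with itself vanishes. -/
theorem homDist_translate (f x : ℝ → StepTwoGroup d) (s t : ℝ) :
    (incr f s t)⁻¹ * translate f x s t = exp (incr x s t).π₁ ((incr x s t).π₂ +
      crossArea f x s t - (1 / 2 : ℝ) • bracket (incr f s t).π₁ (incr x s t).π₁) := by
  apply ext_apply
  · intro i
    rw [mul_π₁, inv_π₁]
    simp [translate]
  · intro i j
    rw [mul_π₂]
    simp only [inv_π₁, inv_π₂, translate, PiLp.add_apply]
    simp only [AddMemClass.coe_add, AddSubgroupClass.coe_sub, SetLike.val_smul, Matrix.add_apply,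
      Matrix.sub_apply, Matrix.smul_apply, smul_eq_mul, bracket_apply]
    ring

theorem abs_crossArea_le {f x : ℝ → StepTwoGroup d} {s t c : ℝ}
    (h₁ : ∀ i j, |youngIntegral (fun u => (incr f s u).π₁ i) (fun u => (x u).π₁ j) s t| ≤ c)
    (h₂ : ∀ i j, |youngIntegral (fun u => (incr x s u).π₁ i) (fun u => (f u).π₁ j) s t| ≤ c)
    (i j : Fin d) : |(crossArea f x s t : Matrix (Fin d) (Fin d) ℝ) i j| ≤ 2 * c := by
  have a₁ := abs_le.1 (h₁ i j)
  have a₂ := abs_le.1 (h₁ j i)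
  have a₃ := abs_le.1 (h₂ i j)
  have a₄ := abs_le.1 (h₂ j i)
  simp only [crossArea, integralTensorD, integralDTensor, Matrix.sub_apply, Matrix.add_apply,
    Matrix.smul_apply, Matrix.of_apply, smul_eq_mul]
  rw [abs_le]
  constructor <;> linarith [a₁.1, a₁.2, a₂.1, a₂.2, a₃.1, a₃.2, a₄.1, a₄.2]

end StepTwoGroup

/-! ### The distance estimate -/

open StepTwoGroup in
theorem mainTheorem11 (d : ℕ) (p q C₀ : ℝ) (hp : 2 ≤ p) (hp' : p < 3)
    (hpq : 1 < 1 / p + 1 / q) :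
    ∃ C : ℝ, 0 < C ∧
      ∀ (x f : ℝ → StepTwoGroup d) (ω κ : ℝ → ℝ → ℝ) (ε : ℝ),
        StepTwoGroup.IsPath x → StepTwoGroup.IsPath f → IsControl ω → IsControl κ →
        0 ≤ ε → ε < 1 →
        StepTwoGroup.VariationControlledBy p (fun s t => ε ^ p * ω s t) x →
        StepTwoGroup.VariationControlledBy q κ f →
        (∀ s t, 0 ≤ s → s ≤ t → t ≤ 1 → κ s t ^ (1 / q) ≤ C₀ * ω s t ^ (1 / p)) →
        ∀ s t, 0 ≤ s → s < t → t ≤ 1 →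
          StepTwoGroup.TranslateDefined f x s t ∧
            StepTwoGroup.homDist (StepTwoGroup.translate f x s t) (StepTwoGroup.incr f s t) ≤
              C * √ε * ω s t ^ (1 / p) := by
  have hp₀ : 0 < p := by linarith
  have hq₀ : 0 < q := by
    have h : 1 / p ≤ 1 / 2 := one_div_le_one_div_of_le two_pos hp
    exact one_div_pos.1 (by linarith)
  have hqp : 1 < 1 / q + 1 / p := by linarith
  set K := sewingConst (1 / q + 1 / p) with hK
  have hK₀ : 0 < K := sewingConst_pos hqp
  -- Contributions to the second level: `1` from the area of `x`, `2 * K * |C₀|` from the cross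
  -- term, `|C₀|` from the bracket. The absolute value keeps `D` nonnegative for any sign of `C₀`.
  set D := 1 + (2 * K + 1) * |C₀| with hD
  have hD₀ : 0 ≤ D := by positivity
  refine ⟨1 + 4 * (d : ℝ) ^ 2 * √D, by positivity, ?_⟩
  intro x f ω κ ε _ _ hω hκ hε hε₁ hx hf hκω s t hs hst ht
  have hxn : ∀ s t, 0 ≤ s → s ≤ t → t ≤ 1 → homNorm (incr x s t) ≤ ε * ω s t ^ (1 / p) :=
    fun s t h₀ h h₁ => homNorm_incr_le hp₀ hε hω hx h₀ h h₁
  have hfn : ∀ s t, 0 ≤ s → s ≤ t → t ≤ 1 → homNorm (incr f s t) ≤ 1 * κ s t ^ (1 / q) :=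
    fun s t h₀ h h₁ => homNorm_incr_le hq₀ zero_le_one hκ (by simpa using hf) h₀ h h₁
  have hI := fun i j => exists_hasYoungIntegral_incr hκ hω hp₀ hq₀ hqp zero_le_one hε hfn hxn
    hs hst.le ht i j
  have hJ := fun i j => exists_hasYoungIntegral_incr hω hκ hq₀ hp₀ hpq hε zero_le_one hxn hfn
    hs hst.le ht i j
  refine ⟨fun i j => ⟨⟨_, (hI i j).choose_spec.1⟩, ⟨_, (hJ i j).choose_spec.1⟩⟩, ?_⟩
  set W := ω s t ^ (1 / p) with hW
  have hW₀ : 0 ≤ W := Real.rpow_nonneg (hω.nonneg s t hs hst.le ht) _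
  have hκW : κ s t ^ (1 / q) ≤ |C₀| * W :=
    (hκω s t hs hst.le ht).trans (mul_le_mul_of_nonneg_right (le_abs_self _) hW₀)
  have hprod : ε * (κ s t ^ (1 / q) * W) ≤ ε * (|C₀| * W ^ 2) := by
    rw [sq, ← mul_assoc |C₀|]
    gcongr
  have hb₁ : ∀ i j, |youngIntegral (fun u => (incr f s u).π₁ i) (fun u => (x u).π₁ j) s t| ≤
      K * (ε * (|C₀| * W ^ 2)) := by
    intro i j
    obtain ⟨I, hI₁, hI₂⟩ := hI i j
    rw [hI₁.youngIntegral_eq hst.le]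
    refine hI₂.trans ?_
    rw [one_mul, mul_assoc]
    gcongr
  have hb₂ : ∀ i j, |youngIntegral (fun u => (incr x s u).π₁ i) (fun u => (f u).π₁ j) s t| ≤
      K * (ε * (|C₀| * W ^ 2)) := by
    intro i j
    obtain ⟨I, hI₁, hI₂⟩ := hJ i j
    rw [hI₁.youngIntegral_eq hst.le]
    refine hI₂.trans ?_
    rw [add_comm (1 / p), mul_one, mul_assoc, mul_comm (ω s t ^ (1 / p))]
    gcongr
  have hx₁ := hxn s t hs hst.le ht
  have hf₁ := hfn s t hs hst.le ht
  rw [one_mul] at hf₁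
  -- The area of `x` is quadratic in `ε`; one power is given up, using `ε < 1`, to match the mixed
  -- terms.
  have hεW : (ε * W) ^ 2 ≤ ε * W ^ 2 := by
    rw [mul_pow]
    gcongr
    nlinarith
  rw [homDist, homDist_translate]
  refine (homNorm_le _ (c := D * ε * W ^ 2) fun i j => ?_).trans ?_
  · have e₁ := (abs_π₂_le (incr x s t) i j).trans
      ((pow_le_pow_left₀ (homNorm_nonneg _) hx₁ 2).trans hεW)
    have e₂ := abs_crossArea_le hb₁ hb₂ i j
    have e₃ : |(1 / 2 : ℝ) * ((incr f s t).π₁ i * (incr x s t).π₁ j -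
        (incr x s t).π₁ i * (incr f s t).π₁ j)| ≤ ε * (|C₀| * W ^ 2) := by
      refine (abs_half_bracket_le _ _ i j).trans ?_
      refine (mul_le_mul ((norm_π₁_le _).trans hf₁) ((norm_π₁_le _).trans hx₁)
        (norm_nonneg _) ((homNorm_nonneg _).trans hf₁)).trans ?_
      linarith
    simp only [AddMemClass.coe_add, AddSubgroupClass.coe_sub, SetLike.val_smul, Matrix.add_apply,
      Matrix.sub_apply, Matrix.smul_apply, smul_eq_mul, bracket_apply]
    rw [abs_le] at e₁ e₂ e₃ ⊢
    have : D * ε * W ^ 2 = ε * W ^ 2 + 2 * (K * (ε * (|C₀| * W ^ 2))) + ε * (|C₀| * W ^ 2) := by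
      rw [hD]
      ring
    rw [this]
    constructor <;> linarith [e₁.1, e₁.2, e₂.1, e₂.2, e₃.1, e₃.2]
  · have hsq : √(D * ε * W ^ 2) = √D * √ε * W := by
      rw [Real.sqrt_mul (by positivity), Real.sqrt_mul hD₀, Real.sqrt_sq hW₀]
    have hε' : ε ≤ √ε := by
      refine Real.le_sqrt_of_sq_le ?_
      nlinarith
    have : ‖(incr x s t).π₁‖ ≤ √ε * W :=
      ((norm_π₁_le _).trans hx₁).trans (mul_le_mul_of_nonneg_right hε' hW₀)
    rw [hsq]
    refine (add_le_add_left this _).trans (le_of_eq ?_)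
    ring
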